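/- Let $\mathbb F\in\{\mathbb R,\mathbb C\}$ and let $E,Q\in\mathbb F^{m,n}$ be (possibly rectangular) matrices; let $X^\star$ denote the conjugate transpose $X^*$ if $\mathbb F=\mathbb C$ and the transpose $X^\top$ if $\mathbb F=\mathbb R$. For $k\ge 0$ let $\mathcal L_k=\lambda\,[\,I_k\ \ 0\,]-[\,0\ \ I_k\,]$, a pencil of size $k\times(k+1)$. The Kronecker canonical form over $\mathbb F$ of a pencil $\lambda E-Q$ is the block diagonal pencil $S(\lambda E-Q)T$, with nonsingular $S\in\mathbb F^{m,m}$, $T\in\mathbb F^{n,n}$, whose diagonal blocks are each of the form $\mathcal L_{\varepsilon}$ ($\varepsilon\ge0$), $\mathcal L_{\eta}^\top$ ($\eta\ge0$), $\lambda I_\rho-J_\rho(\mu)$ ($\rho\ge1$, where $J_\rho(\mu)$ is the upper Jordan block of size $\rho$ with eigenvalue $\mu\in\mathbb F$), $\lambda J_\sigma(0)-I_\sigma$ ($\sigma\ge1$) or, only if $\mathbb F=\mathbb R$, $\lambda I_{2\rho}-C_\rho(a,b)$ ($\rho\ge1$, where $C_\rho(a,b)$ is the real Jordan block of size $2\rho$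 with eigenvalues $a\pm bi$, $a\in\mathbb R$, $b>0$); it is unique up to the order of the blocks. The numbers $\varepsilon$ of its blocks $\mathcal L_\varepsilon$ are the right minimal indices of $\lambda E-Q$, and the numbers $\eta$ of its blocks $\mathcal L_\eta^\top$ are the left minimal indices. If $E^\star Q=Q^\star E$, then all right minimal indices of $\lambda E-Q$ are zero (if there are any). If $EQ^\star=QE^\star$, then all left minimal indices of $\lambda E-Q$ are zero (if there are any). -/

import Mathlib

namespace MatrixPencil

/-- Labels of the diagonal blocks of a Kronecker canonical form over `𝕜` (`ℝ` or `ℂ`).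
* `L ε`: the `ε × (ε + 1)` bidiagonal block `λ [I 0] - [0 I]`;
* `LT η`: the `(η + 1) × η` block that is the transpose of `L η`;
* `J ρ μ`: the `ρ × ρ` Jordan block `λ I - J_ρ(μ)` of the finite eigenvalue `μ`;
* `N σ`: the `σ × σ` nilpotent block `λ J_σ(0) - I`;
* `realJ ρ a b`: the `2ρ × 2ρ` block `λ I - C`, where `C` is the real Jordan block of the pair of
  non-real eigenvalues `a ± b i` (only used in the real case, see `KBlock.Admissible`). -/
inductive KBlock (𝕜 : Type*) where
  | L (ε : ℕ) : KBlock 𝕜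
  | LT (η : ℕ) : KBlock 𝕜
  | J (ρ : ℕ) (μ : 𝕜) : KBlock 𝕜
  | N (σ : ℕ) : KBlock 𝕜
  | realJ (ρ : ℕ) (a b : ℝ) : KBlock 𝕜

namespace KBlock

/-- Square blocks have positive size. Real Jordan blocks occur only over the real field
(that is, when `RCLike.I = 0` in `𝕜`), and only for non-real eigenvalues `a ± b i`, `b > 0`.
There is no restriction on `L ε` and `LT η`: `ε = 0` and `η = 0` are allowed. -/
def Admissible {𝕜 : Type*} [RCLike 𝕜] : KBlock 𝕜 → Prop
  | L _ => True
  | LT _ => True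
  | J ρ _ => 0 < ρ
  | N σ => 0 < σ
  | realJ ρ _ b => (RCLike.I : 𝕜) = 0 ∧ 0 < ρ ∧ 0 < b

/-- The number of rows of a block. -/
def rows {𝕜 : Type*} : KBlock 𝕜 → ℕ
  | L ε => ε
  | LT η => η + 1
  | J ρ _ => ρ
  | N σ => σ
  | realJ ρ _ _ => 2 * ρ

/-- The number of columns of a block. -/
def cols {𝕜 : Type*} : KBlock 𝕜 → ℕ
  | L ε => ε + 1
  | LT η => η
  | J ρ _ => ρ
  | N σ => σ
  | realJ ρ _ _ => 2 * ρ

/-- The matrix `E₀` of the block `λ E₀ - A₀`. -/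
def lead {𝕜 : Type*} [RCLike 𝕜] : (B : KBlock 𝕜) → Matrix (Fin B.rows) (Fin B.cols) 𝕜
  | L _ => Matrix.of fun i j => if (j : ℕ) = (i : ℕ) then 1 else 0
  | LT _ => Matrix.of fun i j => if (i : ℕ) = (j : ℕ) then 1 else 0
  | J _ _ => Matrix.of fun i j => if (i : ℕ) = (j : ℕ) then 1 else 0
  | N _ => Matrix.of fun i j => if (j : ℕ) = (i : ℕ) + 1 then 1 else 0
  | realJ _ _ _ => Matrix.of fun i j => if (i : ℕ) = (j : ℕ) then 1 else 0

/-- The matrix `A₀` of the block `λ E₀ - A₀`. For `realJ ρ a b` it is the block bidiagonal matrix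
with the `2 × 2` block `[a b; -b a]` on the diagonal and `2 × 2` identities above the diagonal. -/
def const {𝕜 : Type*} [RCLike 𝕜] : (B : KBlock 𝕜) → Matrix (Fin B.rows) (Fin B.cols) 𝕜
  | L _ => Matrix.of fun i j => if (j : ℕ) = (i : ℕ) + 1 then 1 else 0
  | LT _ => Matrix.of fun i j => if (i : ℕ) = (j : ℕ) + 1 then 1 else 0
  | J _ μ => Matrix.of fun i j =>
      if (i : ℕ) = (j : ℕ) then μ else if (j : ℕ) = (i : ℕ) + 1 then 1 else 0
  | N _ => Matrix.of fun i j => if (i : ℕ) = (j : ℕ) then 1 else 0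
  | realJ _ a b => Matrix.of fun i j =>
      if (i : ℕ) = (j : ℕ) then (a : 𝕜)
      else if (j : ℕ) = (i : ℕ) + 2 then 1
      else if (j : ℕ) = (i : ℕ) + 1 ∧ (i : ℕ) % 2 = 0 then (b : 𝕜)
      else if (i : ℕ) = (j : ℕ) + 1 ∧ (j : ℕ) % 2 = 0 then -(b : 𝕜)
      else 0

end KBlock

/-- `diagOf M hm hn` is the `m × n` matrix `diag(M 0, …, M (k-1))`, where the (possibly
rectangular, possibly empty) blocks `M i` are placed along the diagonal in their order. -/
def diagOf {𝕜 : Type*} [RCLike 𝕜] {m n k : ℕ} {r c : Fin k → ℕ}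
    (M : (i : Fin k) → Matrix (Fin (r i)) (Fin (c i)) 𝕜)
    (hm : ∑ i, r i = m) (hn : ∑ i, c i = n) : Matrix (Fin m) (Fin n) 𝕜 :=
  Matrix.reindex (finSigmaFinEquiv.trans (finCongr hm)) (finSigmaFinEquiv.trans (finCongr hn))
    (Matrix.blockDiagonal' M)

/-- The blocks `B 0, …, B (k-1)` form a Kronecker canonical form of the pencil `λ E - A` over `𝕜`:
they are admissible and `S (λ E - A) T = diag(B 0, …, B (k-1))` for some nonsingular
`S`, `T` over `𝕜`. The identity of pencils is expressed by its two coefficients. -/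
def IsKroneckerForm {𝕜 : Type*} [RCLike 𝕜] {m n : ℕ} (E A : Matrix (Fin m) (Fin n) 𝕜)
    {k : ℕ} (B : Fin k → KBlock 𝕜) : Prop :=
  (∀ i, (B i).Admissible) ∧
  ∃ (hm : ∑ i, (B i).rows = m) (hn : ∑ i, (B i).cols = n)
    (S : Matrix (Fin m) (Fin m) 𝕜) (T : Matrix (Fin n) (Fin n) 𝕜),
    IsUnit S ∧ IsUnit T ∧
    S * E * T = diagOf (fun i => (B i).lead) hm hn ∧
    S * A * T = diagOf (fun i => (B i).const) hm hn

/-- `ε` is a right minimal index of `λ E - A`: a block of type `L ε` occurs in its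
Kronecker canonical form (which is unique up to the order of the blocks). -/
def IsRightMinimalIndex {𝕜 : Type*} [RCLike 𝕜] {m n : ℕ} (E A : Matrix (Fin m) (Fin n) 𝕜)
    (ε : ℕ) : Prop :=
  ∃ (k : ℕ) (B : Fin k → KBlock 𝕜), IsKroneckerForm E A B ∧ ∃ i, B i = KBlock.L ε

/-- `η` is a left minimal index of `λ E - A`: a block of type `LT η` occurs in its
Kronecker canonical form (which is unique up to the order of the blocks). -/
def IsLeftMinimalIndex {𝕜 : Type*} [RCLike 𝕜] {m n : ℕ} (E A : Matrix (Fin m) (Fin n) 𝕜)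
    (η : ℕ) : Prop :=
  ∃ (k : ℕ) (B : Fin k → KBlock 𝕜), IsKroneckerForm E A B ∧ ∃ i, B i = KBlock.LT η

end MatrixPencil

namespace MatrixPencil

open Matrix

/-! A block `L ε` with `ε ≥ 1` yields vectors with `E x = 0`, `Q x = E y` and `E y ≠ 0`: the columns
of `T` at the last and next-to-last positions of the block. Symmetry of `Eᴴ * Q` excludes such a
chain (`mulVec_eq_zero_of_chain`). Left indices are handled by rows of `S`. One block in one
canonical form suffices, so uniqueness of the form plays no role. -/

open scoped ComplexOrder in
/-- A two-step chain `E x = 0`, `Q x = E y` of the pencil `λ E - Q` is trivial if `Eᴴ Q` is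
Hermitian. -/
theorem mulVec_eq_zero_of_chain {𝕜 : Type*} [RCLike 𝕜] {m n : Type*} [Fintype m] [Fintype n]
    {E Q : Matrix m n 𝕜} (h : Eᴴ * Q = Qᴴ * E) {x y : n → 𝕜}
    (hx : E *ᵥ x = 0) (hxy : Q *ᵥ x = E *ᵥ y) : E *ᵥ y = 0 := by
  -- `(Ey)ᴴ(Ey) = (Qx)ᴴ(Ey) = xᴴ(QᴴE)y = xᴴ(EᴴQ)y = (Ex)ᴴ(Qy) = 0`.
  refine dotProduct_star_self_eq_zero.mp ?_
  nth_rewrite 1 [← hxy]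
  rw [star_mulVec, dotProduct_mulVec, vecMul_vecMul, ← h, ← vecMul_vecMul, ← star_mulVec, hx,
    star_zero, zero_vecMul, zero_dotProduct]

/-- The dual of `mulVec_eq_zero_of_chain`, for row vectors. -/
theorem vecMul_eq_zero_of_chain {𝕜 : Type*} [RCLike 𝕜] {m n : Type*} [Fintype m] [Fintype n]
    {E Q : Matrix m n 𝕜} (h : E * Qᴴ = Q * Eᴴ) {x y : m → 𝕜}
    (hx : x ᵥ* E = 0) (hxy : x ᵥ* Q = y ᵥ* E) : y ᵥ* E = 0 := by
  have key := mulVec_eq_zero_of_chain (E := Eᴴ) (Q := Qᴴ) (x := star x) (y := star y)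
    (by simpa using h) (by rw [← star_vecMul, hx, star_zero])
    (by rw [← star_vecMul, ← star_vecMul, hxy])
  rwa [← star_vecMul, star_eq_zero] at key

namespace KBlock

/-- The witnesses are the last column `ε` and its predecessor `ε - 1`, which exists because `ε ≠ 0`.
-/
theorem exists_col_chain {𝕜 : Type*} [RCLike 𝕜] {b : KBlock 𝕜} {ε : ℕ} (hb : b = L ε)
    (hε : ε ≠ 0) : ∃ c c' : Fin b.cols, (∀ r, b.lead r c = 0) ∧
      (∀ r, b.const r c = b.lead r c') ∧ ∃ r, b.lead r c' ≠ 0 := by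
  subst hb
  refine ⟨⟨ε, by simp [cols]⟩, ⟨ε - 1, by simp only [cols]; omega⟩, fun r => ?_, fun r => ?_,
    ⟨ε - 1, by simp only [rows]; omega⟩, by simp [lead]⟩
  · have : (r : ℕ) < ε := r.2
    simp [lead, this.ne']
  · have : ε = (r : ℕ) + 1 ↔ ε - 1 = (r : ℕ) := by omega
    simp [lead, const, this]

theorem exists_row_chain {𝕜 : Type*} [RCLike 𝕜] {b : KBlock 𝕜} {η : ℕ} (hb : b = LT η)
    (hη : η ≠ 0) : ∃ r r' : Fin b.rows, (∀ c, b.lead r c = 0) ∧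
      (∀ c, b.const r c = b.lead r' c) ∧ ∃ c, b.lead r' c ≠ 0 := by
  subst hb
  refine ⟨⟨η, by simp [rows]⟩, ⟨η - 1, by simp only [rows]; omega⟩, fun c => ?_, fun c => ?_,
    ⟨η - 1, by simp only [cols]; omega⟩, by simp [lead]⟩
  · have : (c : ℕ) < η := c.2
    simp [lead, this.ne']
  · have : η = (c : ℕ) + 1 ↔ η - 1 = (c : ℕ) := by omega
    simp [lead, const, this]

end KBlock

section diagOf

variable {𝕜 : Type*} [RCLike 𝕜] {m n k : ℕ} {r c : Fin k → ℕ}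

/-- The position in `Fin m` of the entry `a` of the block `i`. -/
def blockIndex (hm : ∑ i, r i = m) (i : Fin k) (a : Fin (r i)) : Fin m :=
  finSigmaFinEquiv.trans (finCongr hm) ⟨i, a⟩

theorem exists_blockIndex_eq (hm : ∑ i, r i = m) (p : Fin m) : ∃ i a, blockIndex hm i a = p :=
  let s := (finSigmaFinEquiv.trans (finCongr hm)).symm p
  ⟨s.1, s.2, (finSigmaFinEquiv.trans (finCongr hm)).apply_symm_apply p⟩

theorem diagOf_blockIndex (M : (i : Fin k) → Matrix (Fin (r i)) (Fin (c i)) 𝕜)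
    (hm : ∑ i, r i = m) (hn : ∑ i, c i = n) (i j : Fin k) (a : Fin (r i)) (b : Fin (c j)) :
    diagOf M hm hn (blockIndex hm i a) (blockIndex hn j b) = blockDiagonal' M ⟨i, a⟩ ⟨j, b⟩ := by
  simp only [diagOf, blockIndex, reindex_apply, submatrix_apply, Equiv.symm_apply_apply]

variable {M M' : (i : Fin k) → Matrix (Fin (r i)) (Fin (c i)) 𝕜}

/-- Off block `i` both columns vanish. Two families are allowed so that a `const` column can be
compared with a `lead` column, or a `lead` column with zero. -/
theorem col_diagOf_congr (hm : ∑ i, r i = m) (hn : ∑ i, c i = n) {i : Fin k} {b b' : Fin (c i)}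
    (h : ∀ a, M i a b = M' i a b') :
    (diagOf M hm hn).col (blockIndex hn i b) = (diagOf M' hm hn).col (blockIndex hn i b') := by
  ext p
  obtain ⟨j, a, rfl⟩ := exists_blockIndex_eq hm p
  simp only [col_apply, diagOf_blockIndex]
  by_cases hj : j = i
  · subst hj
    simp only [blockDiagonal'_apply_eq, h]
  · simp only [blockDiagonal'_apply_ne _ _ _ hj]

theorem row_diagOf_congr (hm : ∑ i, r i = m) (hn : ∑ i, c i = n) {i : Fin k} {a a' : Fin (r i)}
    (h : ∀ b, M i a b = M' i a' b) :
    (diagOf M hm hn).row (blockIndex hm i a) = (diagOf M' hm hn).row (blockIndex hm i a') := by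
  ext p
  obtain ⟨j, b, rfl⟩ := exists_blockIndex_eq hn p
  simp only [row_apply, diagOf_blockIndex]
  by_cases hj : i = j
  · subst hj
    simp only [blockDiagonal'_apply_eq, h]
  · simp only [blockDiagonal'_apply_ne _ _ _ hj]

theorem diagOf_zero (hm : ∑ i, r i = m) (hn : ∑ i, c i = n) :
    diagOf (fun i => (0 : Matrix (Fin (r i)) (Fin (c i)) 𝕜)) hm hn = 0 := by
  have : blockDiagonal' (fun i => (0 : Matrix (Fin (r i)) (Fin (c i)) 𝕜)) = 0 :=
    blockDiagonal'_zero
  simp [diagOf, this]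

end diagOf

theorem eq_zero_of_isRightMinimalIndex {𝕜 : Type*} [RCLike 𝕜] {m n : ℕ}
    {E Q : Matrix (Fin m) (Fin n) 𝕜} (h : Eᴴ * Q = Qᴴ * E) {ε : ℕ}
    (hε : IsRightMinimalIndex E Q ε) : ε = 0 := by
  obtain ⟨k, B, ⟨-, hm, hn, S, T, hS, -, hE, hQ⟩, i, hi⟩ := hε
  by_contra hne
  obtain ⟨c, c', h0, h1, r, hr⟩ := KBlock.exists_col_chain hi hne
  have hinj := mulVec_injective_of_isUnit hS
  -- Up to the injective map `S`, columns of `T` see `E` and `Q` in canonical form.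
  have hcol (A : Matrix (Fin m) (Fin n) 𝕜) (q : Fin n) :
      S *ᵥ (A *ᵥ T.col q) = (S * A * T).col q := by
    rw [mulVec_mulVec, ← mulVec_single_one, mulVec_mulVec, mulVec_single_one]
  have key := mulVec_eq_zero_of_chain h (x := T.col (blockIndex hn i c))
    (y := T.col (blockIndex hn i c'))
    (hinj (by
      simp only [hcol, hE, mulVec_zero]
      rw [col_diagOf_congr (M' := fun _ => 0) (b' := c) hm hn h0, diagOf_zero]
      rfl))
    (hinj (by
      simp only [hcol, hE, hQ]
      exact col_diagOf_congr hm hn h1))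
  apply hr
  have := congrFun (congrArg (S *ᵥ ·) key) (blockIndex hm i r)
  simpa only [hcol, hE, col_apply, diagOf_blockIndex, blockDiagonal'_apply_eq, mulVec_zero,
    Pi.zero_apply] using this

theorem eq_zero_of_isLeftMinimalIndex {𝕜 : Type*} [RCLike 𝕜] {m n : ℕ}
    {E Q : Matrix (Fin m) (Fin n) 𝕜} (h : E * Qᴴ = Q * Eᴴ) {η : ℕ}
    (hη : IsLeftMinimalIndex E Q η) : η = 0 := by
  obtain ⟨k, B, ⟨-, hm, hn, S, T, -, hT, hE, hQ⟩, i, hi⟩ := hη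
  by_contra hne
  obtain ⟨r, r', h0, h1, c, hc⟩ := KBlock.exists_row_chain hi hne
  have hinj := vecMul_injective_of_isUnit hT
  have hrow (A : Matrix (Fin m) (Fin n) 𝕜) (p : Fin m) :
      (S.row p ᵥ* A) ᵥ* T = (S * A * T).row p := by
    rw [vecMul_vecMul, ← single_one_vecMul, vecMul_vecMul, single_one_vecMul, Matrix.mul_assoc]
  have key := vecMul_eq_zero_of_chain h (x := S.row (blockIndex hm i r))
    (y := S.row (blockIndex hm i r'))
    (hinj (by
      simp only [hrow, hE, zero_vecMul]
      rw [row_diagOf_congr (M' := fun _ => 0) (a' := r) hm hn h0, diagOf_zero]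
      rfl))
    (hinj (by
      simp only [hrow, hE, hQ]
      exact row_diagOf_congr hm hn h1))
  apply hc
  -- Multiplying by `T` turns the vanishing of `yE` into that of row `r'` of the canonical form,
  -- whose entry at `c` is nonzero.
  have := congrFun (congrArg (· ᵥ* T) key) (blockIndex hn i c)
  simpa only [hrow, hE, row_apply, diagOf_blockIndex, blockDiagonal'_apply_eq, zero_vecMul,
    Pi.zero_apply] using this

end MatrixPencil

open Matrix in
theorem proposition3p4 {𝕜 : Type*} [RCLike 𝕜] {m n : ℕ} (E Q : Matrix (Fin m) (Fin n) 𝕜) :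
    (Eᴴ * Q = Qᴴ * E → ∀ ε : ℕ, MatrixPencil.IsRightMinimalIndex E Q ε → ε = 0) ∧
    (E * Qᴴ = Q * Eᴴ → ∀ η : ℕ, MatrixPencil.IsLeftMinimalIndex E Q η → η = 0) :=
  ⟨fun h _ => MatrixPencil.eq_zero_of_isRightMinimalIndex h,
    fun h _ => MatrixPencil.eq_zero_of_isLeftMinimalIndex h⟩
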